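/- Let $\mathcal{A}$ be a complex Banach algebra with identity $1$, and write $\sigma(b)$ for the spectrum of $b\in\mathcal{A}$. Call $b\in\mathcal{A}$ quasinilpotent if $\sigma(b)=\{0\}$. Call $b\in\mathcal{A}$ generalized Drazin invertible if there is $x\in\mathcal{A}$ with $bx=xb$, $xbx=x$ and $b-b^2x$ quasinilpotent, and let $$\sigma_d(b)=\{\lambda\in\mathbb{C} : b-\lambda 1 \text{ is not generalized Drazin invertible}\}$$ be the generalized Drazin spectrum of $b$. Let $\mathcal{A}^{acc}$ be the set of all $b\in\mathcal{A}$ such that $b-\lambda 1$ is generalized Drazin invertible for every $\lambda\in\mathbb{C}\setminus\{0\}$. Call $b\in\mathcal{A}$ ag-Drazin invertible if there is $x\in\mathcal{A}$ with $bx=xb$, $xbx=x$ and $b-b^2x\in\mathcal{A}^{acc}$, and let $$\sigma_{ad}(b)=\{\lambda\in\mathbb{C} : b-\lambda 1 \text{ is not ag-Drazin invertible}\}$$ be the ag-Drazin spectrum of $b$. For $M\subseteq\mathbb{C}$ let $\mathrm{acc}\,M$ denote the set of accumulation points of $M$ in $\mathbb{C}$. Then for every $a\in\mathcal{A}$: 1.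 $a$ is ag-Drazin invertible if and only if $0\notin\mathrm{acc}\,\sigma_d(a)$; 2. $\sigma_{ad}(a)=\mathrm{acc}\,\sigma_d(a)$. -/

import Mathlib

namespace AGDrazin

variable {A : Type*} [NormedRing A] [NormedAlgebra ℂ A]

/-- `a` is quasinilpotent: its spectrum is `{0}`. -/
def IsQuasinilpotent (a : A) : Prop :=
  spectrum ℂ a = {0}

/-- `a` is generalized Drazin invertible: some `x` commuting with `a` satisfies `x a x = x`
and `a - a² x` is quasinilpotent. -/
def IsGDrazinInvertible (a : A) : Prop :=
  ∃ x : A, Commute a x ∧ x * a * x = x ∧ IsQuasinilpotent (a - a ^ 2 * x)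

/-- The generalized Drazin spectrum `σ_d(a)`. -/
def gDrazinSpectrum (a : A) : Set ℂ :=
  {μ : ℂ | ¬ IsGDrazinInvertible (a - μ • (1 : A))}

/-- Membership in `A^acc`: `a - μ 1` is generalized Drazin invertible for all `μ ≠ 0`. -/
def MemAcc (a : A) : Prop :=
  ∀ μ : ℂ, μ ≠ 0 → IsGDrazinInvertible (a - μ • (1 : A))

/-- `a` is ag-Drazin invertible: some `x` commuting with `a` satisfies `x a x = x`
and `a - a² x` lies in `A^acc`. -/
def IsAGDrazinInvertible (a : A) : Prop :=
  ∃ x : A, Commute a x ∧ x * a * x = x ∧ MemAcc (a - a ^ 2 * x)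

/-- The ag-Drazin spectrum `σ_ad(a)`. -/
def agDrazinSpectrum (a : A) : Set ℂ :=
  {μ : ℂ | ¬ IsAGDrazinInvertible (a - μ • (1 : A))}

end AGDrazin

/-!
The idea is that `0 ∉ acc (acc σ(a))` lets one split off the part of the spectrum near `0`: then
arbitrarily small circles `|z| = r` avoid `σ(a)`. Let `m n` be the coefficient of `z⁻ⁿ` in the
Laurent expansion of the resolvent around such a circle. Comparing coefficients in
`z R(z) = 1 + a R(z)` gives `a m n = m (n + 1)` for `n ≠ 0` and `a m 0 = m 1 - 1`, while
`m n = o(r ^ n)` as `n → ±∞` by the Riemann–Lebesgue lemma. Hence `m 0 * m 1 = m (-n) * m (n + 1)`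
tends to `0`, so it vanishes, and `m 1` is idempotent. With `x = -m 0` this yields `x a x = x` and
`a - a² x = a m 1`, whose powers are the `m (n + 1)`, so that its spectrum lies in `|z| < r`.

Conversely, for any `x` commuting with `a` such that `x a x = x`, the elements `a - a² x` and `a² x`
annihilate each other, so away from `0` the spectrum of `a` is the union of theirs, and `a² x` has
no spectrum in a punctured neighbourhood of `0`. Thus `σ(a)` and `σ(a - a² x)` have the same
germ there, which gives `σ_d = acc σ` and then the result with one more `acc`.
-/

namespace AGDrazin

open Filter Topology Metric Real
open scoped FourierTransform

theorem notMem_derivedSet_iff {X : Type*} [TopologicalSpace X] {x : X} {S : Set X} :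
    x ∉ derivedSet S ↔ ∀ᶠ y in 𝓝[≠] x, y ∉ S := by
  rw [mem_derivedSet, accPt_iff_frequently_nhdsNE, not_frequently]

theorem mem_derivedSet_of_eventually_imp {X : Type*} [TopologicalSpace X] {x : X} {S T : Set X}
    (hx : x ∈ derivedSet S) (h : ∀ᶠ y in 𝓝[≠] x, y ∈ S → y ∈ T) : x ∈ derivedSet T := by
  rw [mem_derivedSet, accPt_iff_frequently_nhdsNE] at hx ⊢
  exact hx.mp h

theorem zero_mem_derivedSet_preimage_add_right {G : Type*} [TopologicalSpace G] [AddGroup G]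
    [ContinuousAdd G] {S : Set G} {g : G} :
    0 ∈ derivedSet ((· + g) ⁻¹' S) ↔ g ∈ derivedSet S := by
  have h := (Homeomorph.addRight g).isOpenEmbedding.accPt_comap_iff (x := 0) (l := 𝓟 S)
  simpa only [mem_derivedSet, comap_principal, Homeomorph.coe_addRight, zero_add] using h

theorem exists_sphere_disjoint_of_notMem_derivedSet_derivedSet {X : Type*} [PseudoMetricSpace X]
    [ProperSpace X] {S : Set X} {x : X} (hx : x ∉ derivedSet (derivedSet S)) {ε : ℝ}
    (hε : 0 < ε) : ∃ r, 0 < r ∧ r < ε ∧ Disjoint (sphere x r) S := by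
  obtain ⟨δ, hδ, hball⟩ :=
    (nhdsWithin_basis_ball.eventually_iff).1 (notMem_derivedSet_iff.1 hx)
  obtain ⟨s, hs, hsmin⟩ := exists_between (lt_min hδ hε)
  let K : Set X := closedBall x s \ ball x (s / 2)
  have hK : IsCompact K := (isCompact_closedBall x s).diff isOpen_ball
  have hfin : (K ∩ S).Finite := by
    by_contra hinf
    obtain ⟨z, ⟨hzs, hz⟩, hzacc⟩ :=
      Set.Infinite.exists_accPt_of_subset_isCompact hinf hK Set.inter_subset_left
    refine hball ⟨closedBall_subset_ball (hsmin.trans_le (min_le_left _ _)) hzs, ?_⟩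
      (derivedSet_mono _ _ Set.inter_subset_right hzacc)
    rintro rfl
    exact hz (mem_ball_self (half_pos hs))
  obtain ⟨r, ⟨hsr, hrs⟩, hr⟩ :=
    (Set.Icc_infinite (half_lt_self hs)).exists_notMem_finite (hfin.image (dist · x))
  refine ⟨r, (half_pos hs).trans_le hsr, hrs.trans_lt (hsmin.trans_le (min_le_right _ _)),
    Set.disjoint_left.2 fun z hzr hzS ↦ hr ⟨z, ⟨⟨?_, ?_⟩, hzS⟩, hzr⟩⟩
  · exact mem_closedBall.2 (hzr.trans_le hrs)
  · exact fun hz ↦ (hsr.trans_eq hzr.symm).not_gt hz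

section CircleAverage

variable {E : Type*} [NormedAddCommGroup E] [NormedSpace ℂ E] {r : ℝ}

theorem circleAverage_zpow_smul_const [CompleteSpace E] (hr : 0 < r) {n : ℤ} (hn : n ≠ 0)
    (e : E) : circleAverage (fun z ↦ z ^ n • e) 0 r = 0 := by
  rw [circleAverage_eq_circleIntegral hr.ne']
  have h : ∮ z in C(0, r), (z - 0)⁻¹ • z ^ n • e = ∮ z in C(0, r), (z - 0) ^ (n - 1) • e := by
    refine circleIntegral.integral_congr hr.le fun z hz ↦ ?_
    simp only [sub_zero, smul_smul, zpow_sub_one₀ (ne_of_mem_sphere hz hr.ne'), mul_comm]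
  rw [h, circleIntegral.integral_smul_const,
    circleIntegral.integral_sub_zpow_of_ne (by lia), zero_smul, smul_zero]

theorem tendsto_inv_zpow_smul_circleAverage_zpow_smul (hr : r ≠ 0) (f : ℂ → E) :
    Tendsto (fun n : ℤ ↦ (r ^ n)⁻¹ • circleAverage (fun z ↦ z ^ n • f z) 0 r) cofinite
      (𝓝 0) := by
  let g : ℝ → E := (Set.Ioc 0 (2 * π)).indicator fun θ ↦ f (circleMap 0 r θ)
  have hfreq : Tendsto (fun n : ℤ ↦ (n : ℝ) * (-(2 * π)⁻¹)) cofinite (cocompact ℝ) :=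
    (tendsto_cocompact_mul_right₀ (by simp [pi_ne_zero])).comp Int.tendsto_coe_cofinite
  have hfourier (n : ℤ) : (r ^ n)⁻¹ • circleAverage (fun z ↦ z ^ n • f z) 0 r
      = (2 * π)⁻¹ • ∫ θ, 𝐞 (-(θ * ((n : ℝ) * (-(2 * π)⁻¹)))) • g θ := by
    rw [circleAverage_def, smul_comm, ← intervalIntegral.integral_smul,
      intervalIntegral.integral_of_le two_pi_pos.le,
      ← MeasureTheory.integral_indicator measurableSet_Ioc]
    congr with θ
    by_cases hθ : θ ∈ Set.Ioc 0 (2 * π)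
    · simp only [g, Set.indicator_of_mem hθ, Circle.smul_def, fourierChar_apply]
      rw [← Complex.coe_smul, smul_smul]
      congr 1
      rw [circleMap_zero_zpow, circleMap_zero, Complex.ofReal_inv, Complex.ofReal_zpow,
        inv_mul_cancel_left₀ (zpow_ne_zero n (Complex.ofReal_ne_zero.2 hr))]
      congr 2
      push_cast
      field_simp
    · simp only [g, Set.indicator_of_notMem hθ, smul_zero]
  simp only [hfourier]
  simpa using ((Real.tendsto_integral_exp_smul_cocompact g).comp hfreq).const_smul (2 * π)⁻¹

end CircleAverage

theorem mul_resolvent {𝕜 B : Type*} [CommSemiring 𝕜] [Ring B] [Algebra 𝕜 B] {b : B} {z : 𝕜}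
    (hz : z ∈ resolventSet 𝕜 b) : b * resolvent b z = z • resolvent b z - 1 := by
  have h : (algebraMap 𝕜 B z - b) * resolvent b z = 1 := Ring.mul_inverse_cancel _ hz
  rw [sub_mul, ← Algebra.smul_def] at h
  rw [← h, sub_sub_cancel]

theorem resolvent_mul {𝕜 B : Type*} [CommSemiring 𝕜] [Ring B] [Algebra 𝕜 B] {b : B} {z : 𝕜}
    (hz : z ∈ resolventSet 𝕜 b) : resolvent b z * b = z • resolvent b z - 1 := by
  have h : resolvent b z * (algebraMap 𝕜 B z - b) = 1 := Ring.inverse_mul_cancel _ hz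
  rw [mul_sub, ← Algebra.commutes, ← Algebra.smul_def] at h
  rw [← h, sub_sub_cancel]

theorem spectrum_subset_ball_of_tendsto_inv_pow_smul_pow {𝕜 B : Type*} [NormedField 𝕜]
    [NormedRing B] [NormedAlgebra 𝕜 B] [CompleteSpace B] {b : B} {r : ℝ} (hr : 0 < r)
    (h : Tendsto (fun n : ℕ ↦ ‖b ^ n‖ / r ^ n) atTop (𝓝 0)) : spectrum 𝕜 b ⊆ ball 0 r := by
  intro μ hμ
  by_contra hμr
  rw [mem_ball_zero_iff, not_lt] at hμr
  refine zero_lt_one.not_ge (ge_of_tendsto (by simpa using h.mul_const ‖(1 : B)‖)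
    (Eventually.of_forall fun n ↦ ?_))
  rw [div_mul_eq_mul_div, one_le_div (pow_pos hr n)]
  calc
    r ^ n ≤ ‖μ‖ ^ n := pow_le_pow_left₀ hr.le hμr n
    _ = ‖μ ^ n‖ := (norm_pow μ n).symm
    _ ≤ ‖b ^ n‖ * ‖(1 : B)‖ :=
      spectrum.norm_le_norm_mul_of_mem (spectrum.pow_mem_pow b n hμ)

section RieszIdempotent

variable {A : Type*} [NormedRing A] [NormedAlgebra ℂ A]

/-- The coefficient of `z⁻ⁿ` in the Laurent expansion of the resolvent `(z - a)⁻¹` around the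
circle `|z| = r`, provided that this circle avoids the spectrum of `a`. The coefficient of `z⁻¹` is
the Riesz idempotent attached to the part of the spectrum inside the circle. -/
noncomputable def resolventLaurentCoeff (a : A) (r : ℝ) (n : ℤ) : A :=
  circleAverage (fun z : ℂ ↦ z ^ n • resolvent a z) 0 r

theorem tendsto_inv_zpow_smul_resolventLaurentCoeff {r : ℝ} (hr : r ≠ 0) (a : A) :
    Tendsto (fun n : ℤ ↦ (r ^ n)⁻¹ • resolventLaurentCoeff a r n) cofinite (𝓝 0) :=
  tendsto_inv_zpow_smul_circleAverage_zpow_smul hr (resolvent a)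

variable [CompleteSpace A] {a : A} {r : ℝ}

theorem circleIntegrable_zpow_smul_resolvent (hr : 0 < r)
    (ha : sphere 0 r ⊆ resolventSet ℂ a) (n : ℤ) :
    CircleIntegrable (fun z ↦ z ^ n • resolvent a z) 0 r :=
  ContinuousOn.circleIntegrable hr.le fun z hz ↦ ContinuousAt.continuousWithinAt <|
    (continuousAt_zpow₀ z n (.inl (ne_of_mem_sphere hz hr.ne'))).smul
      (spectrum.hasDerivAt_resolvent_const_left (ha hz)).continuousAt

theorem map_resolventLaurentCoeff_of_map_resolvent (hr : 0 < r) (ha : sphere 0 r ⊆ resolventSet ℂ a)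
    (L : A →L[ℂ] A) (hL : ∀ z ∈ resolventSet ℂ a, L (resolvent a z) = z • resolvent a z - 1)
    (n : ℤ) : L (resolventLaurentCoeff a r n) =
      resolventLaurentCoeff a r (n + 1) - circleAverage (fun z : ℂ ↦ z ^ n • (1 : A)) 0 r := by
  have hone : CircleIntegrable (fun z : ℂ ↦ z ^ n • (1 : A)) 0 r :=
    ContinuousOn.circleIntegrable hr.le fun z hz ↦ ContinuousAt.continuousWithinAt <|
      (continuousAt_zpow₀ z n (.inl (ne_of_mem_sphere hz hr.ne'))).smul continuousAt_const
  rw [resolventLaurentCoeff, resolventLaurentCoeff, ← circleAverage_fun_sub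
    (circleIntegrable_zpow_smul_resolvent hr ha _) hone]
  refine ((L.restrictScalars ℝ).circleAverage_comp_comm
    (circleIntegrable_zpow_smul_resolvent hr ha n)).symm.trans
    (circleAverage_congr_sphere fun z hz ↦ ?_)
  rw [abs_of_pos hr] at hz
  simp only [Function.comp_apply, ContinuousLinearMap.coe_restrictScalars', map_smul,
    hL z (ha hz), smul_sub, smul_smul, zpow_add_one₀ (ne_of_mem_sphere hz hr.ne')]

theorem commute_resolventLaurentCoeff (hr : 0 < r) (ha : sphere 0 r ⊆ resolventSet ℂ a)
    (n : ℤ) : Commute a (resolventLaurentCoeff a r n) :=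
  (map_resolventLaurentCoeff_of_map_resolvent hr ha (.mul ℂ A a) (fun _ ↦ mul_resolvent) n).trans
    (map_resolventLaurentCoeff_of_map_resolvent hr ha ((ContinuousLinearMap.mul ℂ A).flip a)
      (fun _ ↦ resolvent_mul) n).symm

theorem mul_resolventLaurentCoeff_zero (hr : 0 < r) (ha : sphere 0 r ⊆ resolventSet ℂ a) :
    a * resolventLaurentCoeff a r 0 = resolventLaurentCoeff a r 1 - 1 := by
  simpa only [zpow_zero, one_smul, circleAverage_const, zero_add, ContinuousLinearMap.mul_apply']
    using map_resolventLaurentCoeff_of_map_resolvent hr ha (.mul ℂ A a) (fun _ ↦ mul_resolvent) 0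

theorem mul_resolventLaurentCoeff (hr : 0 < r) (ha : sphere 0 r ⊆ resolventSet ℂ a) {n : ℤ}
    (hn : n ≠ 0) : a * resolventLaurentCoeff a r n = resolventLaurentCoeff a r (n + 1) := by
  simpa only [circleAverage_zpow_smul_const hr hn, sub_zero, ContinuousLinearMap.mul_apply']
    using map_resolventLaurentCoeff_of_map_resolvent hr ha (.mul ℂ A a) (fun _ ↦ mul_resolvent) n

theorem pow_mul_resolventLaurentCoeff (hr : 0 < r) (ha : sphere 0 r ⊆ resolventSet ℂ a) {n : ℤ}
    {k : ℕ} (h : 0 < n ∨ n + k ≤ 0) :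
    a ^ k * resolventLaurentCoeff a r n = resolventLaurentCoeff a r (n + k) := by
  induction k with
  | zero => simp
  | succ k ih =>
    rw [pow_succ', mul_assoc, ih (by lia), mul_resolventLaurentCoeff hr ha (by lia)]
    congr 1
    lia

theorem resolventLaurentCoeff_zero_mul_one (hr : 0 < r) (ha : sphere 0 r ⊆ resolventSet ℂ a) :
    resolventLaurentCoeff a r 0 * resolventLaurentCoeff a r 1 = 0 := by
  have hshift (n : ℕ) : resolventLaurentCoeff a r 0 * resolventLaurentCoeff a r 1 =
      resolventLaurentCoeff a r (-n) * resolventLaurentCoeff a r (1 + n) := by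
    calc
      _ = a ^ n * resolventLaurentCoeff a r (-n) * resolventLaurentCoeff a r 1 := by
        rw [pow_mul_resolventLaurentCoeff hr ha (.inr (neg_add_cancel _).le), neg_add_cancel]
      _ = _ := by
        rw [((commute_resolventLaurentCoeff hr ha _).pow_left n).eq, mul_assoc,
          pow_mul_resolventLaurentCoeff hr ha (.inl one_pos)]
  have hneg : Function.Injective fun n : ℕ ↦ -(n : ℤ) := neg_injective.comp Nat.cast_injective
  have hpos : Function.Injective fun n : ℕ ↦ 1 + (n : ℤ) :=
    (add_right_injective 1).comp Nat.cast_injective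
  have hlim := tendsto_inv_zpow_smul_resolventLaurentCoeff hr.ne' a
  refine tendsto_nhds_unique (f := fun _ : ℕ ↦ _) (l := cofinite) tendsto_const_nhds ?_
  simpa only [Function.comp_def, smul_mul_smul_comm, ← mul_inv, ← zpow_add₀ hr.ne',
    neg_add_cancel_comm_assoc, zpow_one, smul_inv_smul₀ hr.ne', ← hshift, mul_zero, smul_zero]
    using ((hlim.comp hneg.tendsto_cofinite).mul (hlim.comp hpos.tendsto_cofinite)).const_smul r

theorem isIdempotentElem_resolventLaurentCoeff_one (hr : 0 < r)
    (ha : sphere 0 r ⊆ resolventSet ℂ a) : IsIdempotentElem (resolventLaurentCoeff a r 1) := by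
  have hone : resolventLaurentCoeff a r 1 = 1 + a * resolventLaurentCoeff a r 0 := by
    rw [mul_resolventLaurentCoeff_zero hr ha, add_sub_cancel]
  rw [IsIdempotentElem]
  nth_rw 1 [hone]
  rw [add_mul, one_mul, mul_assoc, resolventLaurentCoeff_zero_mul_one hr ha, mul_zero, add_zero]

theorem spectrum_mul_resolventLaurentCoeff_one_subset (hr : 0 < r)
    (ha : sphere 0 r ⊆ resolventSet ℂ a) :
    spectrum ℂ (a * resolventLaurentCoeff a r 1) ⊆ ball 0 r := by
  have hpow {n : ℕ} (hn : n ≠ 0) :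
      (a * resolventLaurentCoeff a r 1) ^ n = resolventLaurentCoeff a r (1 + n) := by
    rw [(commute_resolventLaurentCoeff hr ha 1).mul_pow,
      (isIdempotentElem_resolventLaurentCoeff_one hr ha).pow_eq hn,
      pow_mul_resolventLaurentCoeff hr ha (.inl one_pos)]
  have hinj : Function.Injective fun n : ℕ ↦ 1 + (n : ℤ) :=
    (add_right_injective 1).comp Nat.cast_injective
  have hlim := (((tendsto_inv_zpow_smul_resolventLaurentCoeff hr.ne' a).comp
    hinj.tendsto_cofinite).const_smul r).norm
  rw [smul_zero, norm_zero, Nat.cofinite_eq_atTop] at hlim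
  refine spectrum_subset_ball_of_tendsto_inv_pow_smul_pow hr (hlim.congr' ?_)
  filter_upwards [eventually_ne_atTop 0] with n hn
  rw [hpow hn, Function.comp_apply, smul_smul, norm_smul, zpow_one_add₀ hr.ne', mul_inv,
    mul_inv_cancel_left₀ hr.ne', zpow_natCast, norm_inv, norm_pow, norm_of_nonneg hr.le,
    div_eq_inv_mul]

theorem exists_spectrum_sub_sq_mul_subset_ball_of_sphere_subset (hr : 0 < r)
    (ha : sphere 0 r ⊆ resolventSet ℂ a) :
    ∃ x, Commute a x ∧ x * a * x = x ∧ spectrum ℂ (a - a ^ 2 * x) ⊆ ball 0 r := by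
  have hmul : a * -resolventLaurentCoeff a r 0 = 1 - resolventLaurentCoeff a r 1 := by
    rw [mul_neg, mul_resolventLaurentCoeff_zero hr ha, neg_sub]
  refine ⟨-resolventLaurentCoeff a r 0, (commute_resolventLaurentCoeff hr ha 0).neg_right, ?_, ?_⟩
  · rw [mul_assoc, hmul, mul_sub, mul_one, neg_mul, resolventLaurentCoeff_zero_mul_one hr ha,
      neg_zero, sub_zero]
  · rw [sq, mul_assoc, hmul, mul_sub, mul_one, sub_sub_cancel]
    exact spectrum_mul_resolventLaurentCoeff_one_subset hr ha

end RieszIdempotent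

section SpectralPart

section Algebra

theorem spectrum_sub_smul_one {R B : Type*} [CommRing R] [Ring B] [Algebra R B] (b : B) (μ : R) :
    spectrum R (b - μ • 1) = (· + μ) ⁻¹' spectrum R b := by
  ext z
  rw [Set.mem_preimage, spectrum.add_mem_iff, Algebra.algebraMap_eq_smul_one, sub_eq_neg_add]

variable {𝕜 B : Type*} [Field 𝕜] [Ring B] [Algebra 𝕜 B] {b c x : B} {μ : 𝕜}

theorem mem_spectrum_add_iff_of_mul_eq_zero (hbc : b * c = 0) (hcb : c * b = 0) (hμ : μ ≠ 0) :
    μ ∈ spectrum 𝕜 (b + c) ↔ μ ∈ spectrum 𝕜 b ∨ μ ∈ spectrum 𝕜 c := by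
  have hcomm : Commute (algebraMap 𝕜 B μ - b) (algebraMap 𝕜 B μ - c) :=
    (Algebra.commute_algebraMap_left μ _).sub_left
      ((Algebra.commute_algebraMap_right μ b).sub_right (hbc.trans hcb.symm))
  have hprod : (algebraMap 𝕜 B μ - b) * (algebraMap 𝕜 B μ - c) =
      Units.mk0 μ hμ • (algebraMap 𝕜 B μ - (b + c)) := by
    rw [Units.smul_mk0, Algebra.smul_def, sub_mul, mul_sub, mul_sub, hbc, sub_zero,
      ← Algebra.commutes μ b, mul_sub, mul_add]
    abel
  rw [spectrum.mem_iff, spectrum.mem_iff, spectrum.mem_iff, ← isUnit_smul_iff (Units.mk0 μ hμ),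
    ← hprod, hcomm.isUnit_mul_iff, not_and_or]

theorem mem_spectrum_iff_sub_sq_mul_or_sq_mul (hbx : Commute b x) (hx : x * b * x = x)
    (hμ : μ ≠ 0) :
    μ ∈ spectrum 𝕜 b ↔ μ ∈ spectrum 𝕜 (b - b ^ 2 * x) ∨ μ ∈ spectrum 𝕜 (b ^ 2 * x) := by
  have hcomm : Commute (b - b ^ 2 * x) (b ^ 2 * x) :=
    .sub_left (.mul_right (.self_pow b 2) hbx) (.refl _)
  have hzero : (b - b ^ 2 * x) * (b ^ 2 * x) = 0 := by
    have hmul : x * (b ^ 2 * x) = b * x := by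
      calc
        x * (b ^ 2 * x) = x * b * (b * x) := by simp only [sq, mul_assoc]
        _ = x * b * x * b := by rw [hbx.eq, mul_assoc (x * b)]
        _ = b * x := by rw [hx, hbx.eq]
    rw [sub_mul, mul_assoc (b ^ 2), hmul, ← mul_assoc, ← mul_assoc, ← pow_succ, ← pow_succ',
      sub_self]
  rw [← mem_spectrum_add_iff_of_mul_eq_zero hzero (hcomm.eq ▸ hzero) hμ, sub_add_cancel]

theorem notMem_spectrum_sq_mul_of_isUnit (hbx : Commute b x) (hx : x * b * x = x) (hμ : μ ≠ 0)
    (hunit : IsUnit (1 - μ • x)) : μ ∉ spectrum 𝕜 (b ^ 2 * x) := by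
  have hsq : b ^ 2 * x * x = b * x := by
    rw [sq, mul_assoc b, hbx.eq, mul_assoc, mul_assoc, ← mul_assoc x, hx, hbx.eq]
  have hcorner : b ^ 2 * x * (1 - b * x) = 0 := by
    rw [mul_sub, mul_one, mul_assoc, ← mul_assoc x, hx, sub_self]
  have hprod : (algebraMap 𝕜 B μ - b ^ 2 * x) * (μ⁻¹ • (1 - b * x) - x) = 1 - μ • x := by
    rw [sub_mul, mul_sub, mul_sub, ← Algebra.smul_def, ← Algebra.smul_def, smul_inv_smul₀ hμ,
      mul_smul_comm, hcorner, smul_zero, hsq]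
    abel
  have hbxx : Commute (b ^ 2 * x) x := (hbx.pow_left 2).mul_left (.refl x)
  have hbxb : Commute (b ^ 2 * x) b := ((Commute.refl b).pow_left 2).mul_left hbx.symm
  have hcomm : Commute (algebraMap 𝕜 B μ - b ^ 2 * x) (μ⁻¹ • (1 - b * x) - x) :=
    .sub_left (Algebra.commute_algebraMap_left μ _) <|
      ((((Commute.one_right _).sub_right (hbxb.mul_right hbxx)).smul_right μ⁻¹).sub_right hbxx)
  rw [spectrum.notMem_iff]
  exact (hcomm.isUnit_mul_iff.1 (hprod ▸ hunit)).1

end Algebra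

theorem eventually_mem_spectrum_sub_sq_mul_of_mem {𝕜 B : Type*} [NormedField 𝕜] [NormedRing B]
    [NormedAlgebra 𝕜 B] [CompleteSpace B] {b x : B} (hbx : Commute b x) (hx : x * b * x = x) :
    ∀ᶠ μ in 𝓝[≠] (0 : 𝕜), μ ∈ spectrum 𝕜 b → μ ∈ spectrum 𝕜 (b - b ^ 2 * x) := by
  have hunit : ∀ᶠ μ in 𝓝 (0 : 𝕜), IsUnit (1 - μ • x) := by
    have hcont : Continuous fun μ : 𝕜 ↦ 1 - μ • x := by fun_prop
    exact (hcont.tendsto' 0 1 (by simp)).eventually (Units.isOpen.mem_nhds isUnit_one)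
  filter_upwards [nhdsWithin_le_nhds hunit, self_mem_nhdsWithin] with μ hμx hμ hμb
  exact ((mem_spectrum_iff_sub_sq_mul_or_sq_mul hbx hx hμ).1 hμb).resolve_right
    (notMem_spectrum_sq_mul_of_isUnit hbx hx hμ hμx)

end SpectralPart

section DrazinSpectra

variable {A : Type*} [NormedRing A] [NormedAlgebra ℂ A]

theorem gDrazinSpectrum_sub_smul_one (a : A) (μ : ℂ) :
    gDrazinSpectrum (a - μ • 1) = (· + μ) ⁻¹' gDrazinSpectrum a := by
  ext z
  simp only [gDrazinSpectrum, Set.mem_ofPred_eq, Set.mem_preimage, add_smul, sub_sub, add_comm]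

theorem not_isGDrazinInvertible_of_subsingleton [Subsingleton A] (a : A) :
    ¬ IsGDrazinInvertible a := by
  rintro ⟨x, -, -, hquasi⟩
  rw [IsQuasinilpotent, spectrum.of_subsingleton] at hquasi
  exact (Set.singleton_ne_empty 0) hquasi.symm

variable [CompleteSpace A]

theorem exists_spectrum_sub_sq_mul_subset_ball_of_notMem_derivedSet {a : A}
    (ha : 0 ∉ derivedSet (derivedSet (spectrum ℂ a))) {ε : ℝ} (hε : 0 < ε) :
    ∃ x, Commute a x ∧ x * a * x = x ∧ spectrum ℂ (a - a ^ 2 * x) ⊆ ball 0 ε := by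
  obtain ⟨r, hr, hrε, hdisj⟩ := exists_sphere_disjoint_of_notMem_derivedSet_derivedSet ha hε
  obtain ⟨x, hax, hx, hball⟩ := exists_spectrum_sub_sq_mul_subset_ball_of_sphere_subset hr
    fun z hz ↦ not_not.1 (Set.disjoint_left.1 hdisj hz)
  exact ⟨x, hax, hx, hball.trans (ball_subset_ball hrε.le)⟩

theorem isGDrazinInvertible_iff_notMem_derivedSet_spectrum [Nontrivial A] {a : A} :
    IsGDrazinInvertible a ↔ 0 ∉ derivedSet (spectrum ℂ a) := by
  rw [notMem_derivedSet_iff]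
  constructor
  · rintro ⟨x, hax, hx, hquasi⟩
    filter_upwards [eventually_mem_spectrum_sub_sq_mul_of_mem hax hx, self_mem_nhdsWithin]
      with μ hμ hμ0 hμa
    exact hμ0 (hquasi ▸ hμ hμa)
  · intro hiso
    have hacc : 0 ∉ derivedSet (derivedSet (spectrum ℂ a)) := fun h ↦
      notMem_derivedSet_iff.2 hiso ((isClosed_iff_derivedSet_subset _).1 (isClosed_derivedSet _) h)
    obtain ⟨ε, hε, hball⟩ := nhdsWithin_basis_ball.eventually_iff.1 hiso
    obtain ⟨x, hax, hx, hsub⟩ := exists_spectrum_sub_sq_mul_subset_ball_of_notMem_derivedSet hacc hε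
    refine ⟨x, hax, hx, (spectrum.nonempty _).subset_singleton_iff.1 fun μ hμ ↦ ?_⟩
    by_contra hμ0
    exact hball ⟨hsub hμ, hμ0⟩ ((mem_spectrum_iff_sub_sq_mul_or_sq_mul hax hx hμ0).2 (.inl hμ))

theorem gDrazinSpectrum_eq_derivedSet_spectrum [Nontrivial A] (a : A) :
    gDrazinSpectrum a = derivedSet (spectrum ℂ a) := by
  ext μ
  rw [gDrazinSpectrum, Set.mem_ofPred_eq, isGDrazinInvertible_iff_notMem_derivedSet_spectrum,
    not_not, spectrum_sub_smul_one, zero_mem_derivedSet_preimage_add_right]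

theorem memAcc_iff_notMem_derivedSet_spectrum [Nontrivial A] {a : A} :
    MemAcc a ↔ ∀ μ ≠ 0, μ ∉ derivedSet (spectrum ℂ a) := by
  simp only [← gDrazinSpectrum_eq_derivedSet_spectrum, gDrazinSpectrum, Set.mem_ofPred_eq, not_not,
    MemAcc, ne_eq]

theorem isAGDrazinInvertible_iff_notMem_derivedSet_derivedSet [Nontrivial A] {a : A} :
    IsAGDrazinInvertible a ↔ 0 ∉ derivedSet (derivedSet (spectrum ℂ a)) := by
  rw [notMem_derivedSet_iff]
  constructor
  · rintro ⟨x, hax, hx, hacc⟩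
    filter_upwards [eventually_eventually_nhdsWithin.2
      (eventually_mem_spectrum_sub_sq_mul_of_mem hax hx), self_mem_nhdsWithin] with μ hμ hμ0 hμa
    rw [isOpen_compl_singleton.nhdsWithin_eq hμ0] at hμ
    exact memAcc_iff_notMem_derivedSet_spectrum.1 hacc μ hμ0
      (mem_derivedSet_of_eventually_imp hμa (nhdsWithin_le_nhds hμ))
  · intro h
    obtain ⟨ε, hε, hball⟩ := nhdsWithin_basis_ball.eventually_iff.1 h
    obtain ⟨x, hax, hx, hsub⟩ :=
      exists_spectrum_sub_sq_mul_subset_ball_of_notMem_derivedSet (notMem_derivedSet_iff.2 h) hε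
    refine ⟨x, hax, hx, memAcc_iff_notMem_derivedSet_spectrum.2 fun μ hμ0 hμ ↦ ?_⟩
    have hμε : μ ∈ ball 0 ε :=
      hsub ((isClosed_iff_derivedSet_subset _).1 (spectrum.isClosed _) hμ)
    refine hball ⟨hμε, hμ0⟩ (mem_derivedSet_of_eventually_imp hμ ?_)
    filter_upwards [nhdsWithin_le_nhds (isOpen_ne.mem_nhds hμ0)] with z hz0 hz
    exact (mem_spectrum_iff_sub_sq_mul_or_sq_mul hax hx hz0).2 (.inl hz)

theorem isAGDrazinInvertible_iff_notMem_derivedSet_gDrazinSpectrum {a : A} :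
    IsAGDrazinInvertible a ↔ 0 ∉ derivedSet (gDrazinSpectrum a) := by
  cases subsingleton_or_nontrivial A
  · have huniv : gDrazinSpectrum a = Set.univ :=
      Set.eq_univ_of_forall fun _ ↦ not_isGDrazinInvertible_of_subsingleton _
    have hzero : (0 : ℂ) ∈ derivedSet Set.univ :=
      (PerfectSpace.univ_perfect ℂ).acc 0 (Set.mem_univ 0)
    rw [huniv, iff_false_right (not_not.2 hzero)]
    rintro ⟨x, -, -, hacc⟩
    exact not_isGDrazinInvertible_of_subsingleton _ (hacc 1 one_ne_zero)
  · rw [gDrazinSpectrum_eq_derivedSet_spectrum,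
      isAGDrazinInvertible_iff_notMem_derivedSet_derivedSet]

theorem agDrazinSpectrum_eq_derivedSet_gDrazinSpectrum (a : A) :
    agDrazinSpectrum a = derivedSet (gDrazinSpectrum a) := by
  ext μ
  rw [agDrazinSpectrum, Set.mem_ofPred_eq,
    isAGDrazinInvertible_iff_notMem_derivedSet_gDrazinSpectrum, not_not,
    gDrazinSpectrum_sub_smul_one, zero_mem_derivedSet_preimage_add_right]

end DrazinSpectra

end AGDrazin

theorem mainTheorem2 {A : Type*} [NormedRing A] [NormedAlgebra ℂ A] [CompleteSpace A] (a : A) :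
    (AGDrazin.IsAGDrazinInvertible a ↔ (0 : ℂ) ∉ derivedSet (AGDrazin.gDrazinSpectrum a)) ∧
      AGDrazin.agDrazinSpectrum a = derivedSet (AGDrazin.gDrazinSpectrum a) :=
  ⟨AGDrazin.isAGDrazinInvertible_iff_notMem_derivedSet_gDrazinSpectrum,
    AGDrazin.agDrazinSpectrum_eq_derivedSet_gDrazinSpectrum a⟩
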